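/- Let $G$ be a finite directed multigraph (loops and parallel edges allowed) with a rotation system, i.e. a clockwise cyclic order of the edge ends around each vertex. A directed circuit is a closed directed walk, with at least one edge, that repeats no edge (vertices may be repeated); circuits are considered up to the choice of starting point. Assume: (C1) every vertex has exactly two incoming and two outgoing edges; (C2) the rotation system describes a cellular embedding of $G$ in the torus (i.e. $G$ is connected and non-empty and $|V|-|E|+|F|=0$, where $F$ is the set of facial walks), and every facial walk has length at least $3$; (C3) no directed circuit of $G$ is contractible on the torus, i.e. none can be transformed into a constant walk by successively inserting or deleting spurs (an edge followed at once by its reverse) and facial walks. Under these conditions the edges around every vertex appear, in clockwise order, as left outgoing, right outgoing, right incoming, left incoming. Let $\mathcal P$ be the osculating partition of $G$: the unique partition of the edges into directed circuits such that a circuit entering a vertex by its left (right) incoming edge always continues with the left (right) outgoing edge of that vertex. Its members are the osculating circuits of $G$. If some osculating circuit $P\in\mathcal P$ visits a vertex twice, then $P$ is the only osculating circuit, i.e. $\mathcal P=\{P\}$. -/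

import Mathlib

/-- A directed multigraph (loops and parallel edges allowed) with vertex set `V` and edge set `E`,
together with a rotation system. A dart is an edge with a marked end: `(e, true)` is the end of `e`
at its tail (the edge is outgoing there), `(e, false)` is the end at its head (incoming).
`rot d` is the dart that follows `d` in clockwise order around the vertex at which `d` sits. -/
structure RotationDigraph (V E : Type*) where
  src : E → V
  tgt : E → V
  rot : Equiv.Perm (E × Bool)
  /-- `rot` cyclically permutes the darts at each vertex: two darts are in the same cycle of `rot`
  exactly when they sit at the same vertex. -/
  sameCycle_rot_iff : ∀ d d' : E × Bool, rot.SameCycle d d' ↔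
    (bif d.2 then src d.1 else tgt d.1) = (bif d'.2 then src d'.1 else tgt d'.1)

namespace RotationDigraph

variable {V E : Type*} (G : RotationDigraph V E)

/-- The vertex at which a dart sits. -/
def at_ (d : E × Bool) : V := bif d.2 then G.src d.1 else G.tgt d.1

/-- The opposite end of the same edge. -/
def rev : Equiv.Perm (E × Bool) := Equiv.prodCongr (Equiv.refl E) Equiv.boolNot

/-- A dart `d` is also read as the traversal of its edge starting at `d`; so `(e, true)` traverses
`e` forwards and `(e, false)` traverses it backwards. `IsWalk u l v` says that the list `l` of
traversals is a (not necessarily directed) walk from `u` to `v`. -/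
inductive IsWalk : V → List (E × Bool) → V → Prop
  | nil (v : V) : IsWalk v [] v
  | cons (d : E × Bool) (l : List (E × Bool)) (v : V) :
      IsWalk (G.at_ (rev d)) l v → IsWalk (G.at_ d) (d :: l) v

/-- Face tracing: traverse `d`, then leave along the next edge in the rotation. -/
def faceNext : Equiv.Perm (E × Bool) := rev.trans G.rot

/-- The faces of the embedding described by the rotation system: orbits of face tracing. -/
def Face : Type _ := Quotient (Equiv.Perm.SameCycle.setoid G.faceNext)

/-- Length of the facial walk through `d` (an edge traversed twice is counted twice). -/
noncomputable def faceLength (d : E × Bool) : ℕ := Function.minimalPeriod G.faceNext d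

/-- The facial walk that starts with the traversal `d`. -/
noncomputable def facialWalk (d : E × Bool) : List (E × Bool) :=
  List.iterate G.faceNext d (G.faceLength d)

/-- Elementary homotopy: `l'` arises from `l` by removing a spur (an edge followed at once by its
reverse) or a complete facial walk. -/
def ElemHomotopy (l l' : List (E × Bool)) : Prop :=
  ∃ p c q, l = p ++ c ++ q ∧ l' = p ++ q ∧ ∃ d, c = [d, rev d] ∨ c = G.facialWalk d

/-- Homotopy, with fixed ends, of walks from `u` to `v` on the surface obtained by gluing a disk
into each facial walk: the equivalence relation generated by elementary homotopies of walks. -/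
def Homotopic (u v : V) : List (E × Bool) → List (E × Bool) → Prop :=
  Relation.EqvGen fun l l' => G.IsWalk u l v ∧ G.IsWalk u l' v ∧ G.ElemHomotopy l l'

/-- A directed circuit: a nonempty cyclic sequence of distinct edges, in which each edge ends where
the next one starts. Vertices may be repeated. -/
def IsDirectedCircuit (c : Cycle E) : Prop :=
  c ≠ Cycle.nil ∧ c.Nodup ∧ c.Chain fun e f => G.tgt e = G.src f

/-- A circuit is contractible if, from some starting point, it is homotopic to a constant walk. -/
def IsContractible (c : Cycle E) : Prop :=
  ∃ l : List E, (l : Cycle E) = c ∧ ∃ v : V, G.Homotopic v v (l.map fun e => (e, true)) []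

/-- Every vertex has exactly two outgoing and exactly two incoming edges. -/
def C1 : Prop := ∀ v, {e | G.src e = v}.ncard = 2 ∧ {e | G.tgt e = v}.ncard = 2

/-- The rotation system describes a cellular embedding into the torus (the graph is connected and
the Euler characteristic `|V| - |E| + |F|` is zero), all of whose facial walks have length at
least three. -/
def C2 : Prop :=
  (Nonempty V ∧ ∀ u v, ∃ l, G.IsWalk u l v) ∧
  (Nat.card V : ℤ) - Nat.card E + Nat.card G.Face = 0 ∧
  ∀ d, 3 ≤ G.faceLength d

/-- No directed circuit is contractible. -/
def C3 : Prop := ∀ c, G.IsDirectedCircuit c → ¬ G.IsContractible c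

/- Sides at a vertex whose clockwise order of edges is: left outgoing, right outgoing, right
incoming, left incoming. -/

def LeftOut (e : E) : Prop := (G.rot (e, true)).2 = true
def RightOut (e : E) : Prop := (G.rot.symm (e, true)).2 = true
def RightIn (e : E) : Prop := (G.rot (e, false)).2 = false
def LeftIn (e : E) : Prop := (G.rot.symm (e, false)).2 = false

/-- A passage through a vertex, entering along `e` and leaving along `f`, that stays on one side. -/
def SameSide (e f : E) : Prop :=
  (G.LeftIn e ∧ G.LeftOut f) ∨ (G.RightIn e ∧ G.RightOut f)

/-- A partition of the edges into directed circuits each of whose passages through a vertex stays on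
one side of that vertex, so that no two passages cross transversely: at every vertex one passage
uses the two left edges and the other one the two right edges. -/
structure IsOsculatingPartition (Part : Set (Cycle E)) : Prop where
  circuit : ∀ c ∈ Part, G.IsDirectedCircuit c
  partition : ∀ e, ∃! c, c ∈ Part ∧ e ∈ c
  osculating : ∀ c ∈ Part, c.Chain G.SameSide

/-- The circuit `c` visits some vertex (at least) twice. -/
def VisitsTwice (c : Cycle E) : Prop :=
  ∃ e ∈ c, ∃ f ∈ c, e ≠ f ∧ G.src e = G.src f

/- The osculating partition is well defined: under the condition `C3'` below, which is what makes
the sides of a vertex meaningful, it exists and is unique. -/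

/-- At every vertex two outgoing edges are consecutive in the rotation. -/
def C3' : Prop := ∀ v, ∃ e, G.src e = v ∧ G.LeftOut e

theorem mem_of_closed [Finite E] (S : Set (E × Bool)) (hS : ∀ d ∈ S, G.rot d ∈ S)
    {a d : E × Bool} (ha : a ∈ S) (h : G.at_ a = G.at_ d) : d ∈ S := by
  obtain ⟨n, -, rfl⟩ := ((G.sameCycle_rot_iff a d).2 h).exists_pow_eq'
  clear h
  induction n with
  | zero => simpa using ha
  | succ n ih => rw [pow_succ']; exact hS _ ih

theorem at_rot (d : E × Bool) : G.at_ (G.rot d) = G.at_ d :=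
  (G.sameCycle_rot_iff _ _).1 (Equiv.Perm.sameCycle_apply_left.2 (Equiv.Perm.SameCycle.refl _ _))

theorem local_order [Finite E] (h1 : G.C1) (h3 : G.C3') (v : V) : ∃ x y z t,
    G.rot (x, true) = (y, true) ∧ G.rot (y, true) = (z, false) ∧
    G.rot (z, false) = (t, false) ∧ G.rot (t, false) = (x, true) ∧ x ≠ y ∧ z ≠ t ∧
    (∀ e, G.src e = v ↔ e = x ∨ e = y) ∧ (∀ e, G.tgt e = v ↔ e = z ∨ e = t) := by
  obtain ⟨p, q, hpq, ho⟩ := Set.ncard_eq_two.1 (h1 v).1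
  obtain ⟨r, s, hrs, hi⟩ := Set.ncard_eq_two.1 (h1 v).2
  have ho : ∀ e, G.src e = v ↔ e = p ∨ e = q := fun e => by
    have := Set.ext_iff.1 ho e; simpa using this
  have hi : ∀ e, G.tgt e = v ↔ e = r ∨ e = s := fun e => by
    have := Set.ext_iff.1 hi e; simpa using this
  have inj : ∀ {d d'}, G.rot d = G.rot d' → d = d' := fun h => G.rot.injective h
  have hat : ∀ d d', G.at_ d = v → G.rot d = d' → G.at_ d' = v :=
    fun d d' h h' => by rw [← h', at_rot, h]
  have hr : G.at_ (r, false) = v := (hi r).2 (.inl rfl)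
  have hs : G.at_ (s, false) = v := (hi s).2 (.inr rfl)
  have cl := fun S hS a d ha h => G.mem_of_closed (E := E) S hS (a := a) (d := d) ha h
  obtain ⟨x, hx, hx'⟩ := h3 v
  have ax : G.at_ (x, true) = v := hx
  obtain ⟨y, hy⟩ : ∃ y, G.rot (x, true) = (y, true) := ⟨(G.rot (x, true)).1, Prod.ext rfl hx'⟩
  have ay := hat _ _ ax hy
  have hxy : x ≠ y := by
    rintro rfl
    have := cl {(x, true)} (by simp [hy]) _ _ rfl (ax.trans hr.symm)
    simp at this
  have ho' : ∀ e, G.src e = v ↔ e = x ∨ e = y := by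
    have h1 := (ho x).1 ax
    have h2 := (ho y).1 ay
    intro e; rw [ho]; grind
  obtain ⟨z, hz⟩ : ∃ z, G.rot (y, true) = (z, false) := by
    obtain ⟨z, b, hz⟩ : ∃ z b, G.rot (y, true) = (z, b) := ⟨_, _, rfl⟩
    have az := hat _ _ ay hz
    cases b with
    | false => exact ⟨z, hz⟩
    | true =>
      rcases (ho' z).1 az with rfl | rfl
      · have := cl {(z, true), (y, true)} (by simp [hy, hz]) _ _ (.inl rfl) (ax.trans hr.symm)
        simp at this
      · have := inj (hy.trans hz.symm); simp_all
  have az := hat _ _ ay hz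
  obtain ⟨t, ht⟩ : ∃ t, G.rot (z, false) = (t, false) := by
    obtain ⟨t, b, ht⟩ : ∃ t b, G.rot (z, false) = (t, b) := ⟨_, _, rfl⟩
    have at' := hat _ _ az ht
    cases b with
    | false => exact ⟨t, ht⟩
    | true =>
      rcases (ho' t).1 at' with rfl | rfl
      · have hc := cl {(t, true), (y, true), (z, false)} (by simp [hy, hz, ht])
        have h1 := hc _ _ (.inl rfl) (ax.trans hr.symm)
        have h2 := hc _ _ (.inl rfl) (ax.trans hs.symm)
        simp at h1 h2
        exact absurd (h1.trans h2.symm) hrs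
      · have := inj (hy.trans ht.symm); simp_all
  have at' := hat _ _ az ht
  have hzt : z ≠ t := by
    rintro rfl
    have := inj (hz.trans ht.symm); simp_all
  have hi' : ∀ e, G.tgt e = v ↔ e = z ∨ e = t := by
    have h1 := (hi z).1 az
    have h2 := (hi t).1 at'
    intro e; rw [hi]; grind
  refine ⟨x, y, z, t, hy, hz, ht, ?_, hxy, hzt, ho', hi'⟩
  obtain ⟨u, b, hu⟩ : ∃ u b, G.rot (t, false) = (u, b) := ⟨_, _, rfl⟩
  have au := hat _ _ at' hu
  cases b with
  | true =>
    rcases (ho' u).1 au with rfl | rfl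
    · exact hu
    · have := inj (hy.trans hu.symm); simp_all
  | false =>
    rcases (hi' u).1 au with rfl | rfl
    · have := inj (hz.trans hu.symm); simp_all
    · have := inj (ht.trans hu.symm); simp_all

theorem exists_next [Finite E] (h1 : G.C1) (h3 : G.C3') : ∃ f : E → E, Function.Injective f ∧
    ∀ e e', (G.tgt e = G.src e' ∧ G.SameSide e e') ↔ e' = f e := by
  have key : ∀ v, ∃ x y z t, x ≠ y ∧ z ≠ t ∧
    (∀ e, G.src e = v ↔ e = x ∨ e = y) ∧ (∀ e, G.tgt e = v ↔ e = z ∨ e = t) ∧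
    G.LeftOut x ∧ ¬ G.LeftOut y ∧ ¬ G.RightOut x ∧ G.RightOut y ∧
    G.RightIn z ∧ ¬ G.RightIn t ∧ ¬ G.LeftIn z ∧ G.LeftIn t := by
    intro v
    obtain ⟨x, y, z, t, a, b, c, d, hxy, hzt, ho, hi⟩ := G.local_order h1 h3 v
    refine ⟨x, y, z, t, hxy, hzt, ho, hi, ?_⟩
    have a' := G.rot.symm_apply_eq.2 a.symm
    have b' := G.rot.symm_apply_eq.2 b.symm
    have c' := G.rot.symm_apply_eq.2 c.symm
    have d' := G.rot.symm_apply_eq.2 d.symm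
    simp [LeftOut, RightOut, RightIn, LeftIn, a, b, c, d, a', b', c', d']
  have hex : ∀ e, ∃ f, ∀ e', (G.tgt e = G.src e' ∧ G.SameSide e e') ↔ e' = f := by
    intro e
    obtain ⟨x, y, z, t, hxy, hzt, ho, hi, h⟩ := key (G.tgt e)
    rcases (hi e).1 rfl with rfl | rfl
    · refine ⟨y, fun e' => ?_⟩
      rw [eq_comm, ho e', SameSide]; grind
    · refine ⟨x, fun e' => ?_⟩
      rw [eq_comm, ho e', SameSide]; grind
  choose f hf using hex
  refine ⟨f, fun e₁ e₂ h12 => ?_, hf⟩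
  have a := (hf e₁ (f e₁)).2 rfl
  have b := (hf e₂ (f e₁)).2 h12
  obtain ⟨x, y, z, t, hxy, hzt, ho, hi, h⟩ := key (G.src (f e₁))
  have a1 := (hi e₁).1 a.1
  have b1 := (hi e₂).1 b.1
  have c1 := (ho (f e₁)).1 rfl
  have a2 := a.2
  have b2 := b.2
  rw [SameSide] at a2 b2
  grind

theorem chain_eq_periodicOrbit {f : E → E} {c : Cycle E} (hn : c.Nodup)
    (hc : c.Chain fun e e' => e' = f e) {e : E} (he : e ∈ c) :
    c = Function.periodicOrbit f e := by
  obtain ⟨l, rfl⟩ : ∃ l : List E, ((e :: l : List E) : Cycle E) = c := by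
    induction c using Quotient.ind with | _ l =>
    obtain ⟨p, q, rfl⟩ := List.append_of_mem (Cycle.mem_coe_iff.1 he)
    exact ⟨q ++ p, Cycle.coe_eq_coe.2
      (by simpa using List.IsRotated.symm (List.isRotated_append (l := p) (l' := e :: q)))⟩
  rw [Cycle.chain_coe_cons] at hc
  have hnd : (e :: l).Nodup := by simpa using hn
  have hget := List.isChain_iff_getElem.1 hc
  have hit : ∀ (i : ℕ) (hi : i < (e :: (l ++ [e])).length), (e :: (l ++ [e]))[i] = f^[i] e := by
    intro i
    induction i with
    | zero => intro _; rfl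
    | succ i ih =>
      intro hi
      rw [Function.iterate_succ_apply', ← ih (by omega)]
      exact hget i hi
  have hper : f^[l.length + 1] e = e := by
    have := hit (l.length + 1) (by simp)
    rw [← this]; simp
  have hpp : Function.IsPeriodicPt f (l.length + 1) e := hper
  have hit' : ∀ (i : ℕ) (hi : i < (e :: l).length), (e :: l)[i] = f^[i] e := by
    intro i hi
    rw [← hit i (by simp at hi ⊢; omega)]
    exact (List.getElem_append_left (as := e :: l) (bs := [e]) hi).symm
  have hmp : Function.minimalPeriod f e = l.length + 1 := by
    have hle := hpp.minimalPeriod_le (by omega)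
    have hpos := hpp.minimalPeriod_pos (by omega)
    by_contra hne
    have h0 := hit' 0 (by simp)
    have hk := hit' (Function.minimalPeriod f e) (by simp; omega)
    rw [Function.iterate_minimalPeriod] at hk
    have := (hnd.getElem_inj_iff (hi := by simp; omega) (hj := by simp)).1 (hk.trans h0.symm)
    omega
  rw [Function.periodicOrbit, hmp]
  congr 1
  refine List.ext_getElem (by simp) fun i h1 h2 => ?_
  rw [hit' i h1]; simp only [List.getElem_map, List.getElem_range]

/-- The osculating partition exists and is unique. -/
theorem existsUnique_isOsculatingPartition [Finite E] (h1 : G.C1) (h3 : G.C3') :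
    ∃! Part, G.IsOsculatingPartition Part := by
  obtain ⟨f, hinj, hf⟩ := G.exists_next h1 h3
  have hp : ∀ e, e ∈ Function.periodicPts f := fun e => hinj.mem_periodicPts e
  have hch : ∀ e, (Function.periodicOrbit f e).Chain fun e e' => e' = f e := fun e =>
    (Function.periodicOrbit_chain' _ (hp e)).2 fun n => by rw [Function.iterate_succ_apply']
  have hdet : ∀ c : Cycle E, c.Nodup → (c.Chain fun e e' => e' = f e) → ∀ e ∈ c,
      c = Function.periodicOrbit f e := fun c a b e h => chain_eq_periodicOrbit a b h
  refine ⟨Set.range (Function.periodicOrbit f), ⟨?_, ?_, ?_⟩, fun Q hQ => ?_⟩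
  · rintro _ ⟨e, rfl⟩
    refine ⟨fun h => ?_, Function.nodup_periodicOrbit,
      (hch e).imp fun a b h => ((hf a b).2 h).1⟩
    exact Function.periodicOrbit_eq_nil_iff_not_periodic_pt.1 h (hp e)
  · intro e
    refine ⟨_, ⟨⟨e, rfl⟩, Function.self_mem_periodicOrbit (hp e)⟩, ?_⟩
    rintro _ ⟨⟨e', rfl⟩, h⟩
    exact hdet _ Function.nodup_periodicOrbit (hch e') e h
  · rintro _ ⟨e, rfl⟩
    exact (hch e).imp fun a b h => ((hf a b).2 h).2
  · have hc : ∀ c ∈ Q, ∀ e ∈ c, c = Function.periodicOrbit f e := fun c hc e he => by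
      refine hdet c (hQ.circuit c hc).2.1 ?_ e he
      have a := (hQ.circuit c hc).2.2
      have b := hQ.osculating c hc
      clear he
      induction c with
      | nil => trivial
      | cons x l _ =>
        rw [Cycle.chain_coe_cons] at a b ⊢
        rw [List.isChain_iff_getElem] at a b ⊢
        exact fun i hi => (hf _ _).1 ⟨a i hi, b i hi⟩
    ext c
    constructor
    · intro h
      induction c with
      | nil => exact absurd rfl (hQ.circuit _ h).1
      | cons x l _ => exact ⟨x, (hc _ h x (by simp)).symm⟩
    · rintro ⟨e, rfl⟩
      obtain ⟨c, ⟨h, h'⟩, -⟩ := hQ.partition e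
      rw [← hc c h e h']; exact h

end RotationDigraph

namespace RotationDigraph

variable {V E : Type*} (G : RotationDigraph V E)

/-! No face is bounded by equally directed edges, since its boundary or the reverse would be a
contractible directed circuit. So each face has a corner between two outgoing edges (a source).
There is one such corner per vertex, and `|E| = 2|V|` with Euler characteristic 0 gives `|F| = |V|`;
hence each face has exactly one source (`eq_of_sameCycle_lo`). Its boundary is then two directed
paths with common ends. Inner passages of the right path go from left incoming to left outgoing
edges and those of the left path from right incoming to right outgoing edges, so each path lies in
one osculating circuit.

Let `P` use both outgoing edges at `v₀`. Following `P` from there, the face on the right of the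
current edge always has its right path in `P`, and symmetrically on the left (`lo_mem_iff_ro_mem`).
Thus at every vertex `P` contains all four edges or none, and connectivity finishes the proof. -/

theorem rev_rev (d : E × Bool) : rev (rev d) = d := by
  obtain ⟨e, b⟩ := d
  simp [rev]

theorem at_faceNext (d : E × Bool) : G.at_ (G.faceNext d) = G.at_ (rev d) :=
  G.at_rot _

variable {G}

/-! ### Walks, homotopies and directed circuits -/

theorem IsWalk.append {u v w : V} {l l' : List (E × Bool)} (h : G.IsWalk u l v)
    (h' : G.IsWalk v l' w) : G.IsWalk u (l ++ l') w := by
  induction h with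
  | nil => exact h'
  | cons d l v _ ih => exact IsWalk.cons d _ _ (ih h')

theorem IsWalk.singleton (d : E × Bool) : G.IsWalk (G.at_ d) [d] (G.at_ (rev d)) :=
  IsWalk.cons d [] _ (IsWalk.nil _)

theorem IsWalk.reverse {u v : V} {l : List (E × Bool)} (h : G.IsWalk u l v) :
    G.IsWalk v (l.reverse.map rev) u := by
  induction h with
  | nil => exact IsWalk.nil _
  | cons d l v _ ih =>
    have := IsWalk.singleton (G := G) (rev d)
    rw [rev_rev] at this
    simpa using ih.append this

theorem IsWalk.eq_of_nil {u v : V} (h : G.IsWalk u [] v) : u = v := by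
  cases h; rfl

theorem IsWalk.of_cons {u v : V} {d : E × Bool} {l : List (E × Bool)}
    (h : G.IsWalk u (d :: l) v) : u = G.at_ d ∧ G.IsWalk (G.at_ (rev d)) l v := by
  cases h; exact ⟨rfl, by assumption⟩

theorem IsWalk.exists_of_append {u w : V} {l l' : List (E × Bool)}
    (h : G.IsWalk u (l ++ l') w) : ∃ v, G.IsWalk u l v ∧ G.IsWalk v l' w := by
  induction l generalizing u with
  | nil => exact ⟨u, IsWalk.nil _, h⟩
  | cons d l ih =>
    obtain ⟨rfl, h'⟩ := IsWalk.of_cons h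
    obtain ⟨v, h1, h2⟩ := ih h'
    exact ⟨v, IsWalk.cons _ _ _ h1, h2⟩

theorem IsWalk.homotopic_append_reverse {u v : V} {l : List (E × Bool)} (h : G.IsWalk u l v) :
    G.Homotopic u u (l ++ l.reverse.map rev) [] := by
  induction l using List.reverseRecOn generalizing v with
  | nil => exact Relation.EqvGen.refl _
  | append_singleton l d ih =>
    obtain ⟨w, h1, -⟩ := h.exists_of_append
    refine Relation.EqvGen.trans _ _ _ (Relation.EqvGen.rel _ _ ⟨h.append h.reverse,
      h1.append h1.reverse, l, [d, rev d], l.reverse.map rev, ?_, rfl, d, .inl rfl⟩) (ih h1)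
    simp

/-- For a closed walk, taking `e` to be the first edge supplies the wrap-around condition of a
cyclic chain. -/
theorem IsWalk.isChain {u w : V} {l : List E} (h : G.IsWalk u (l.map fun e => (e, true)) w)
    (e : E) (he : G.src e = w) :
    (l ++ [e]).IsChain (fun e f => G.tgt e = G.src f) ∧
      ∀ f ∈ (l ++ [e]).head?, G.src f = u := by
  induction l generalizing u with
  | nil => simpa [he] using (IsWalk.eq_of_nil h).symm
  | cons a l ih =>
    obtain ⟨rfl, h'⟩ := IsWalk.of_cons h
    obtain ⟨h1, h2⟩ := ih h'
    refine ⟨?_, fun f hf => ?_⟩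
    · rw [List.cons_append, List.isChain_cons]
      exact ⟨fun f hf => (h2 f hf).symm, h1⟩
    · simp only [List.cons_append, List.head?_cons, Option.mem_def, Option.some.injEq] at hf
      subst hf; rfl

theorem IsWalk.isDirectedCircuit {u : V} {l : List E}
    (h : G.IsWalk u (l.map fun e => (e, true)) u) (hl : l ≠ []) (hn : l.Nodup) :
    G.IsDirectedCircuit (l : Cycle E) := by
  refine ⟨by simpa using hl, by simpa using hn, ?_⟩
  cases l with
  | nil => exact absurd rfl hl
  | cons a l =>
    rw [Cycle.chain_coe_cons]
    exact (h.isChain a (IsWalk.of_cons h).1.symm).1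

variable (G)

/-! ### Facial walks -/

theorem sameCycle_faceNext (d : E × Bool) : G.faceNext.SameCycle d (G.faceNext d) :=
  Equiv.Perm.sameCycle_apply_right.2 (Equiv.Perm.SameCycle.refl _ _)

theorem isWalk_iterate (d : E × Bool) (n : ℕ) :
    G.IsWalk (G.at_ d) (List.iterate G.faceNext d n) (G.at_ (G.faceNext^[n] d)) := by
  induction n generalizing d with
  | zero => exact IsWalk.nil _
  | succ n ih =>
    have := ih (G.faceNext d)
    rw [at_faceNext] at this
    exact IsWalk.cons _ _ _ this

theorem isWalk_facialWalk (d : E × Bool) : G.IsWalk (G.at_ d) (G.facialWalk d) (G.at_ d) := by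
  have := G.isWalk_iterate d (G.faceLength d)
  rwa [faceLength, Function.iterate_minimalPeriod] at this

theorem facialWalk_ne_nil (d : E × Bool) (h : 3 ≤ G.faceLength d) : G.facialWalk d ≠ [] := by
  intro h0
  have := congrArg List.length h0
  simp [facialWalk] at this
  omega

theorem nodup_facialWalk (d : E × Bool) : (G.facialWalk d).Nodup := by
  have h : Function.periodicOrbit G.faceNext d = (G.facialWalk d : Cycle (E × Bool)) := by
    rw [Function.periodicOrbit, facialWalk, faceLength]
    congr 1
    exact (List.range_map_iterate _ _ _)
  have := Function.nodup_periodicOrbit (f := G.faceNext) (x := d)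
  rwa [h, Cycle.nodup_coe_iff] at this

theorem sameCycle_of_mem_facialWalk {d x : E × Bool} (h : x ∈ G.facialWalk d) :
    G.faceNext.SameCycle d x := by
  rw [facialWalk, List.mem_iterate] at h
  obtain ⟨m, -, rfl⟩ := h
  exact ⟨m, by rw [zpow_natCast, Equiv.Perm.iterate_eq_pow]⟩

theorem homotopic_facialWalk (d : E × Bool) :
    G.Homotopic (G.at_ d) (G.at_ d) (G.facialWalk d) [] :=
  Relation.EqvGen.rel _ _ ⟨G.isWalk_facialWalk d, IsWalk.nil _, [], G.facialWalk d, [],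
    by simp, rfl, d, .inr rfl⟩

/-- Elementary homotopies remove facial walks in the tracing direction only. Inserting one in front
of its reverse leaves spurs that cancel. -/
theorem homotopic_reverse_facialWalk (d : E × Bool) :
    G.Homotopic (G.at_ d) (G.at_ d) ((G.facialWalk d).reverse.map rev) [] := by
  have h := G.isWalk_facialWalk d
  refine Relation.EqvGen.trans _ _ _ (Relation.EqvGen.symm _ _ (Relation.EqvGen.rel _ _
    ⟨h.append h.reverse, h.reverse, [], G.facialWalk d, _, ?_, rfl, d, .inr rfl⟩))
    h.homotopic_append_reverse
  simp

/-- No facial walk consists of equally directed traversals. -/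
theorem exists_sameCycle_snd_eq (h2 : G.C2) (h3 : G.C3) (d : E × Bool) (b : Bool) :
    ∃ e, G.faceNext.SameCycle d (e, b) := by
  by_contra! hb
  have hm : ∀ x ∈ G.facialWalk d, x.2 = !b := by
    rintro ⟨e, b'⟩ hx
    by_contra hne
    obtain rfl : b' = b := by simpa using hne
    exact hb e (G.sameCycle_of_mem_facialWalk hx)
  have hne := G.facialWalk_ne_nil d (h2.2.2 d)
  -- Distinct traversals with the same direction use distinct edges.
  have hnd : ((G.facialWalk d).map Prod.fst).Nodup :=
    (G.nodup_facialWalk d).map_on fun x hx y hy hxy =>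
      Prod.ext hxy ((hm x hx).trans (hm y hy).symm)
  cases b with
  | false =>
    have hmap : ((G.facialWalk d).map Prod.fst).map (fun e => (e, true)) = G.facialWalk d := by
      rw [List.map_map]
      conv_rhs => rw [← List.map_id (G.facialWalk d)]
      exact List.map_congr_left fun x hx => Prod.ext rfl (hm x hx).symm
    have hw := G.isWalk_facialWalk d
    have hh := G.homotopic_facialWalk d
    rw [← hmap] at hw hh
    exact h3 _ (hw.isDirectedCircuit (by simpa using hne) hnd) ⟨_, rfl, _, hh⟩
  | true =>
    -- Every traversal is backward here, so the reversed facial walk is the directed circuit.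
    have hmap : ((G.facialWalk d).reverse.map Prod.fst).map (fun e => (e, true)) =
        (G.facialWalk d).reverse.map rev := by
      rw [List.map_map]
      refine List.map_congr_left fun x hx => Prod.ext rfl ?_
      have := hm x (List.mem_reverse.1 hx)
      simp [rev, this]
    have hw := (G.isWalk_facialWalk d).reverse
    have hh := G.homotopic_reverse_facialWalk d
    rw [← hmap] at hw hh
    refine h3 _ (hw.isDirectedCircuit (by simpa using hne) ?_) ⟨_, rfl, _, hh⟩
    rw [List.map_reverse]
    exact List.nodup_reverse.2 hnd

variable {G}

/-! ### Passages of osculating circuits -/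

theorem exists_mem_of_chain {r : E → E → Prop} {c : Cycle E} (hc : c.Chain r) {e : E}
    (he : e ∈ c) : ∃ e' ∈ c, r e e' := by
  obtain ⟨l, rfl⟩ : ∃ l : List E, ((e :: l : List E) : Cycle E) = c := by
    induction c using Quotient.ind with | _ l =>
    obtain ⟨p, q, rfl⟩ := List.append_of_mem (Cycle.mem_coe_iff.1 he)
    exact ⟨q ++ p, Cycle.coe_eq_coe.2
      (by simpa using List.IsRotated.symm (List.isRotated_append (l := p) (l' := e :: q)))⟩
  rw [Cycle.chain_coe_cons] at hc
  cases l with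
  | nil => exact ⟨e, he, by simpa using hc⟩
  | cons a l => exact ⟨a, by simp, by simpa using (List.isChain_cons_cons.1 hc).1⟩

theorem IsOsculatingPartition.chain {Part : Set (Cycle E)}
    (hPart : G.IsOsculatingPartition Part) {c : Cycle E} (hc : c ∈ Part) :
    c.Chain fun e f => G.tgt e = G.src f ∧ G.SameSide e f := by
  have a := (hPart.circuit c hc).2.2
  have b := hPart.osculating c hc
  induction c with
  | nil => trivial
  | cons x l _ =>
    rw [Cycle.chain_coe_cons] at a b ⊢
    rw [List.isChain_iff_getElem] at a b ⊢
    exact fun i hi => ⟨a i hi, b i hi⟩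

theorem IsOsculatingPartition.exists_next {Part : Set (Cycle E)}
    (hPart : G.IsOsculatingPartition Part) {c : Cycle E} (hc : c ∈ Part) {e : E} (he : e ∈ c) :
    ∃ e' ∈ c, G.tgt e = G.src e' ∧ G.SameSide e e' :=
  exists_mem_of_chain (hPart.chain hc) he

theorem IsOsculatingPartition.eq_of_mem {Part : Set (Cycle E)}
    (hPart : G.IsOsculatingPartition Part) {c c' : Cycle E} (hc : c ∈ Part) (hc' : c' ∈ Part)
    {e : E} (he : e ∈ c) (he' : e ∈ c') : c = c' :=
  (hPart.partition e).unique ⟨hc, he⟩ ⟨hc', he'⟩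

/-- The existence of an osculating partition forces two outgoing edges to be consecutive. -/
theorem IsOsculatingPartition.c3' {Part : Set (Cycle E)}
    (hPart : G.IsOsculatingPartition Part) (h1 : G.C1) : G.C3' := by
  intro v
  obtain ⟨e, rfl⟩ : {e | G.tgt e = v}.Nonempty :=
    Set.nonempty_of_ncard_ne_zero (by rw [(h1 v).2]; decide)
  obtain ⟨c, ⟨hc, he⟩, -⟩ := hPart.partition e
  obtain ⟨f, -, hf, h⟩ := hPart.exists_next hc he
  rcases h with ⟨-, h⟩ | ⟨-, h⟩
  · exact ⟨f, hf.symm, h⟩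
  -- Here `f` is right outgoing, so the dart preceding it in the rotation is the left outgoing one.
  · refine ⟨(G.rot.symm (f, true)).1, ?_, ?_⟩
    · have h' := G.at_rot (G.rot.symm (f, true))
      rw [Equiv.apply_symm_apply] at h'
      rw [hf]
      simpa [at_, RightOut] using (h'.trans (by rw [at_, h]; rfl)).symm
    · have : ((G.rot.symm (f, true)).1, true) = G.rot.symm (f, true) := Prod.ext rfl h.symm
      rw [LeftOut, this, Equiv.apply_symm_apply]

theorem card_edge_eq [Finite V] [Finite E] (h1 : G.C1) : Nat.card E = 2 * Nat.card V := by
  have := Fintype.ofFinite V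
  have e := Nat.card_congr (Equiv.sigmaFiberEquiv G.src).symm
  rw [e, Nat.card_sigma]
  have h : ∀ v, Nat.card {e // G.src e = v} = 2 := fun v => (h1 v).1
  simp [h, mul_comm]

variable (G)

/-- `lo`, `ro`, `ri`, `li` name the left outgoing, right outgoing, right incoming and left incoming
edges at every vertex. -/
structure IsLabelling (lo ro ri li : V → E) : Prop where
  rot_lo : ∀ v, G.rot (lo v, true) = (ro v, true)
  rot_ro : ∀ v, G.rot (ro v, true) = (ri v, false)
  rot_ri : ∀ v, G.rot (ri v, false) = (li v, false)
  rot_li : ∀ v, G.rot (li v, false) = (lo v, true)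
  lo_ne_ro : ∀ v, lo v ≠ ro v
  ri_ne_li : ∀ v, ri v ≠ li v
  src_eq : ∀ v e, G.src e = v ↔ e = lo v ∨ e = ro v
  tgt_eq : ∀ v e, G.tgt e = v ↔ e = ri v ∨ e = li v

theorem exists_isLabelling [Finite E] (h1 : G.C1) (h3 : G.C3') :
    ∃ lo ro ri li, G.IsLabelling lo ro ri li := by
  choose lo ro ri li h using G.local_order h1 h3
  exact ⟨lo, ro, ri, li, fun v => (h v).1, fun v => (h v).2.1, fun v => (h v).2.2.1,
    fun v => (h v).2.2.2.1, fun v => (h v).2.2.2.2.1, fun v => (h v).2.2.2.2.2.1,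
    fun v => (h v).2.2.2.2.2.2.1, fun v => (h v).2.2.2.2.2.2.2⟩

variable {G}

namespace IsLabelling

/-! ### The four corners at a vertex and the sources of faces -/

variable {lo ro ri li : V → E}

theorem faceNext_li (hL : G.IsLabelling lo ro ri li) (v : V) :
    G.faceNext (li v, true) = (lo v, true) := hL.rot_li v

theorem faceNext_ri (hL : G.IsLabelling lo ro ri li) (v : V) :
    G.faceNext (ri v, true) = (li v, false) := hL.rot_ri v

theorem faceNext_lo (hL : G.IsLabelling lo ro ri li) (v : V) :
    G.faceNext (lo v, false) = (ro v, true) := hL.rot_lo v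

theorem faceNext_ro (hL : G.IsLabelling lo ro ri li) (v : V) :
    G.faceNext (ro v, false) = (ri v, false) := hL.rot_ro v

theorem eq_lo_or_ro (hL : G.IsLabelling lo ro ri li) (e : E) : ∃ v, e = lo v ∨ e = ro v :=
  ⟨G.src e, (hL.src_eq _ e).1 rfl⟩

theorem eq_ri_or_li (hL : G.IsLabelling lo ro ri li) (e : E) : ∃ v, e = ri v ∨ e = li v :=
  ⟨G.tgt e, (hL.tgt_eq _ e).1 rfl⟩

theorem li_ne_ri (hL : G.IsLabelling lo ro ri li) (v w : V) : li v ≠ ri w := by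
  intro h
  have h1 := (hL.tgt_eq v _).2 (.inr rfl)
  have h2 := (hL.tgt_eq w _).2 (.inl rfl)
  rw [h, h2] at h1
  subst h1
  exact hL.ri_ne_li _ h.symm

theorem li_injective (hL : G.IsLabelling lo ro ri li) {v w : V} (h : li v = li w) : v = w := by
  rw [← (hL.tgt_eq v _).2 (.inr rfl), h]
  exact (hL.tgt_eq w _).2 (.inr rfl)

theorem ri_injective (hL : G.IsLabelling lo ro ri li) {v w : V} (h : ri v = ri w) : v = w := by
  rw [← (hL.tgt_eq v _).2 (.inl rfl), h]
  exact (hL.tgt_eq w _).2 (.inl rfl)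

/-- Every face has a corner between two outgoing edges. -/
theorem exists_sameCycle_lo [Finite E] (hL : G.IsLabelling lo ro ri li) (h2 : G.C2) (h3 : G.C3)
    (d : E × Bool) : ∃ v, G.faceNext.SameCycle d (lo v, false) := by
  by_contra! hd
  obtain ⟨e, he⟩ := G.exists_sameCycle_snd_eq h2 h3 d false
  obtain ⟨e', he'⟩ := G.exists_sameCycle_snd_eq h2 h3 d true
  -- Face tracing changes from backward to forward only at a source corner; without one it can never
  -- reach `(e', true)`.
  have key : ∀ n : ℕ, ((G.faceNext ^ n) (e, false)).2 = false := by
    intro n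
    induction n with
    | zero => rfl
    | succ n ih =>
      obtain ⟨a, ha⟩ : ∃ a, (G.faceNext ^ n) (e, false) = (a, false) := ⟨_, Prod.ext rfl ih⟩
      rw [pow_succ', Equiv.Perm.mul_apply, ha]
      obtain ⟨v, rfl | rfl⟩ := hL.eq_lo_or_ro a
      · exact absurd (he.trans ⟨n, by simpa using ha⟩) (hd v)
      · rw [hL.faceNext_ro]
  obtain ⟨n, -, hn⟩ := (he.symm.trans he').exists_pow_eq'
  have := key n
  rw [hn] at this
  exact Bool.noConfusion this

/-- Every face has at most one corner between two outgoing edges. -/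
theorem eq_of_sameCycle_lo [Finite V] [Finite E] (hL : G.IsLabelling lo ro ri li)
    (h1 : G.C1) (h2 : G.C2) (h3 : G.C3) {v w : V}
    (h : G.faceNext.SameCycle (lo v, false) (lo w, false)) : v = w := by
  let F : V → G.Face := fun v => Quotient.mk _ (lo v, false)
  have hF : Function.Surjective F := by
    intro q
    induction q using Quotient.ind with | _ d =>
    obtain ⟨v, hv⟩ := hL.exists_sameCycle_lo h2 h3 d
    exact ⟨v, Quotient.sound hv.symm⟩
  have hcard : Nat.card V = Nat.card G.Face := by
    have a := h2.2.1
    have b := card_edge_eq h1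
    omega
  have : Finite G.Face := Finite.of_surjective F hF
  -- A surjection between finite sets of equal size is injective.
  exact ((Nat.bijective_iff_surjective_and_card F).2 ⟨hF, hcard⟩).1 (Quotient.sound h)

/-! ### The two boundary paths of a face -/

variable {S : Set E}

/-- The right boundary of a face lies in a single osculating circuit. -/
theorem mem_iff_of_sameCycle_true [Finite V] [Finite E] (hL : G.IsLabelling lo ro ri li)
    (h1 : G.C1) (h2 : G.C2) (h3 : G.C3) (hl : ∀ v, li v ∈ S ↔ lo v ∈ S) {v : V} {e : E}
    (h : G.faceNext.SameCycle (lo v, false) (e, true)) : e ∈ S ↔ ro v ∈ S := by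
  obtain ⟨n, -, hn⟩ := h.exists_pow_eq'
  clear h
  induction n generalizing e with
  | zero => simp at hn
  | succ n ih =>
    obtain ⟨a, b, hab⟩ : ∃ a b, (G.faceNext ^ n) (lo v, false) = (a, b) := ⟨_, _, rfl⟩
    rw [pow_succ', Equiv.Perm.mul_apply, hab] at hn
    cases b with
    | true =>
      rw [← ih hab]
      obtain ⟨w, rfl | rfl⟩ := hL.eq_ri_or_li a
      · simp [hL.faceNext_ri] at hn
      · rw [hL.faceNext_li, Prod.mk.injEq] at hn
        rw [← hn.1, hl]
    | false =>
      obtain ⟨w, rfl | rfl⟩ := hL.eq_lo_or_ro a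
      -- A step from backward to forward is a source corner, hence the corner at `v`, and the right
      -- path restarts at `ro v`.
      · obtain rfl := hL.eq_of_sameCycle_lo h1 h2 h3 ⟨n, by simpa using hab⟩
        rw [hL.faceNext_lo, Prod.mk.injEq] at hn
        rw [← hn.1]
      · simp [hL.faceNext_ro] at hn

/-- The left boundary of a face lies in a single osculating circuit. -/
theorem mem_iff_of_sameCycle_false [Finite V] [Finite E] (hL : G.IsLabelling lo ro ri li)
    (h1 : G.C1) (h2 : G.C2) (h3 : G.C3) (hr : ∀ v, ri v ∈ S ↔ ro v ∈ S) {v : V} {e : E}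
    (h : G.faceNext.SameCycle (e, false) (lo v, false)) : e ∈ S ↔ lo v ∈ S := by
  obtain ⟨n, -, hn⟩ := h.exists_pow_eq'
  clear h
  induction n generalizing e with
  | zero =>
    simp only [pow_zero, Equiv.Perm.coe_one, id_eq, Prod.mk.injEq, and_true] at hn
    rw [hn]
  | succ n ih =>
    obtain ⟨w, rfl | rfl⟩ := hL.eq_lo_or_ro e
    -- The induction runs towards the source, and any source met on the way is already the one at
    -- `v`.
    · obtain rfl := hL.eq_of_sameCycle_lo h1 h2 h3 ⟨(n + 1 : ℕ), by rw [zpow_natCast]; exact hn⟩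
      rfl
    · rw [pow_succ, Equiv.Perm.mul_apply, hL.faceNext_ro] at hn
      rw [← ih hn, hr]

/-! ### Propagation along an osculating circuit -/

theorem exists_eq_of_sameSide (hL : G.IsLabelling lo ro ri li) {e f : E}
    (h : G.tgt e = G.src f) (hs : G.SameSide e f) :
    ∃ w, (e = li w ∧ f = lo w) ∨ (e = ri w ∧ f = ro w) := by
  refine ⟨G.tgt e, ?_⟩
  have he := (hL.tgt_eq (G.tgt e) e).1 rfl
  have hf := (hL.src_eq (G.tgt e) f).1 h.symm
  generalize G.tgt e = w at he hf
  have a := G.rot.symm_apply_eq.2 (hL.rot_lo w).symm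
  have b := G.rot.symm_apply_eq.2 (hL.rot_ro w).symm
  have c := G.rot.symm_apply_eq.2 (hL.rot_ri w).symm
  have d := G.rot.symm_apply_eq.2 (hL.rot_li w).symm
  rcases he with rfl | rfl <;> rcases hf with rfl | rfl <;>
    simp_all [SameSide, LeftIn, LeftOut, RightIn, RightOut, hL.rot_lo, hL.rot_ro, hL.rot_ri,
      hL.rot_li]

theorem mem_iff_li_lo (hL : G.IsLabelling lo ro ri li) {Part : Set (Cycle E)}
    (hPart : G.IsOsculatingPartition Part) {c : Cycle E} (hc : c ∈ Part) (v : V) :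
    li v ∈ c ↔ lo v ∈ c := by
  have key : ∀ c ∈ Part, li v ∈ c → lo v ∈ c := by
    intro c hc h
    obtain ⟨e', he', ht, hs⟩ := hPart.exists_next hc h
    obtain ⟨w, ⟨h4, rfl⟩ | ⟨h4, rfl⟩⟩ := hL.exists_eq_of_sameSide ht hs
    · rwa [hL.li_injective h4]
    · exact absurd h4 (hL.li_ne_ri _ _)
  -- For the converse, the member containing `li v` also contains `lo v`, so it is `c` by
  -- disjointness.
  refine ⟨key c hc, fun h => ?_⟩
  obtain ⟨c', ⟨hc', h'⟩, -⟩ := hPart.partition (li v)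
  rwa [hPart.eq_of_mem hc hc' h (key c' hc' h')]

theorem mem_iff_ri_ro (hL : G.IsLabelling lo ro ri li) {Part : Set (Cycle E)}
    (hPart : G.IsOsculatingPartition Part) {c : Cycle E} (hc : c ∈ Part) (v : V) :
    ri v ∈ c ↔ ro v ∈ c := by
  have key : ∀ c ∈ Part, ri v ∈ c → ro v ∈ c := by
    intro c hc h
    obtain ⟨e', he', ht, hs⟩ := hPart.exists_next hc h
    obtain ⟨w, ⟨h4, rfl⟩ | ⟨h4, rfl⟩⟩ := hL.exists_eq_of_sameSide ht hs
    · exact absurd h4.symm (hL.li_ne_ri _ _)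
    · rwa [hL.ri_injective h4]
  refine ⟨key c hc, fun h => ?_⟩
  obtain ⟨c', ⟨hc', h'⟩, -⟩ := hPart.partition (ri v)
  rwa [hPart.eq_of_mem hc hc' h (key c' hc' h')]

/-- A property that is inherited by the next edge of an osculating circuit holds on the whole
circuit as soon as it holds for one edge. -/
theorem forall_mem_of_mem (hL : G.IsLabelling lo ro ri li) {Part : Set (Cycle E)}
    (hPart : G.IsOsculatingPartition Part) {c : Cycle E} (hc : c ∈ Part) {p : E → Prop}
    (hp : ∀ w, p (li w) → p (lo w)) (hp' : ∀ w, p (ri w) → p (ro w))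
    {e f : E} (he : e ∈ c) (hpe : p e) (hf : f ∈ c) : p f := by
  -- For a transitive relation, a cyclic chain relates every ordered pair of its members.
  have : IsTrans E (fun a b => p a → p b) := ⟨fun _ _ _ h h' => h' ∘ h⟩
  suffices hchain : c.Chain fun a b => p a → p b from
    Cycle.chain_iff_pairwise.1 hchain e he f hf hpe
  refine (hPart.chain hc).imp fun a b hab => ?_
  obtain ⟨w, ⟨rfl, rfl⟩ | ⟨rfl, rfl⟩⟩ := hL.exists_eq_of_sameSide hab.1 hab.2
  · exact hp w
  · exact hp' w

/-- If an osculating circuit uses all edges at one vertex, then it uses all edges at every vertex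
that it visits. -/
theorem lo_mem_iff_ro_mem [Finite V] [Finite E] (hL : G.IsLabelling lo ro ri li)
    (h1 : G.C1) (h2 : G.C2) (h3 : G.C3) {Part : Set (Cycle E)}
    (hPart : G.IsOsculatingPartition Part) {c : Cycle E} (hc : c ∈ Part) {v₀ : V}
    (hlo : lo v₀ ∈ c) (hro : ro v₀ ∈ c) (v : V) : lo v ∈ c ↔ ro v ∈ c := by
  have hl := hL.mem_iff_li_lo hPart hc
  have hr := hL.mem_iff_ri_ro hPart hc
  have right : ∀ {v e}, G.faceNext.SameCycle (lo v, false) (e, true) → (e ∈ c ↔ ro v ∈ c) :=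
    fun h => hL.mem_iff_of_sameCycle_true (S := {e | e ∈ c}) h1 h2 h3 hl h
  have left : ∀ {v e}, G.faceNext.SameCycle (ro v, true) (e, false) → (e ∈ c ↔ lo v ∈ c) := by
    refine fun {v e} h => hL.mem_iff_of_sameCycle_false (S := {e | e ∈ c}) h1 h2 h3 hr ?_
    have := G.sameCycle_faceNext (lo v, false)
    rw [hL.faceNext_lo] at this
    exact (this.trans h).symm
  constructor
  · intro h
    -- The property says that the face on the right of `e` has its right path in `c`. A passage `ri
    -- w`, `ro w` stays at the same face. At a passage `li w`, `lo w` the old face has its sink at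
    -- `w`, which puts `ri w` and then `ro w` in `c`; the right path of the new face starts with `ro
    -- w`.
    have := hL.forall_mem_of_mem hPart hc
      (p := fun e => ∀ e', G.faceNext.SameCycle (e, false) (e', true) → e' ∈ c)
      (fun w hw e' he' => ?_) (fun w hw e' he' => hw e' ?_) hlo
      (fun e' he' => (right he').2 hro) h
    · exact this _ (hL.faceNext_lo v ▸ G.sameCycle_faceNext _)
    · exact (right he').2 ((hr w).1 (hw _ (hL.faceNext_ri w ▸ G.sameCycle_faceNext _).symm))
    · exact (hL.faceNext_ro w ▸ G.sameCycle_faceNext (ro w, false)).symm.trans he'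
  · intro h
    -- The mirror image: the face on the left of `e` and its left path.
    have := hL.forall_mem_of_mem hPart hc
      (p := fun e => ∀ e', G.faceNext.SameCycle (e, true) (e', false) → e' ∈ c)
      (fun w hw e' he' => hw e' ?_) (fun w hw e' he' => ?_) hro
      (fun e' he' => (left he').2 hlo) h
    · exact this _ (hL.faceNext_lo v ▸ G.sameCycle_faceNext (lo v, false)).symm
    · exact (hL.faceNext_li w ▸ G.sameCycle_faceNext (li w, true)).trans he'
    · exact (left he').2 ((hl w).1 (hw _ (hL.faceNext_ri w ▸ G.sameCycle_faceNext _)))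

/-- All four edges at a vertex have the same membership, so membership can be carried along
undirected walks. -/
theorem mem_iff_of_at (hL : G.IsLabelling lo ro ri li) (hl : ∀ v, li v ∈ S ↔ lo v ∈ S)
    (hr : ∀ v, ri v ∈ S ↔ ro v ∈ S) (h : ∀ v, lo v ∈ S ↔ ro v ∈ S) (d : E × Bool) :
    d.1 ∈ S ↔ lo (G.at_ d) ∈ S := by
  obtain ⟨e, b⟩ := d
  cases b with
  | true =>
    rcases (hL.src_eq _ e).1 rfl with h' | h'
    · conv_lhs => rw [h']
      rfl
    · conv_lhs => rw [h']
      exact (h _).symm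
  | false =>
    rcases (hL.tgt_eq _ e).1 rfl with h' | h'
    · conv_lhs => rw [h']
      exact (hr _).trans (h _).symm
    · conv_lhs => rw [h']
      exact hl _

end IsLabelling

end RotationDigraph

theorem mainTheorem6 {V E : Type*} [Finite V] [Finite E] (G : RotationDigraph V E)
    (h1 : G.C1) (h2 : G.C2) (h3 : G.C3)
    (Part : Set (Cycle E)) (hPart : G.IsOsculatingPartition Part)
    (P : Cycle E) (hP : P ∈ Part) (hP2 : G.VisitsTwice P) :
    Part = {P} := by
  obtain ⟨lo, ro, ri, li, hL⟩ := G.exists_isLabelling h1 (hPart.c3' h1)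
  -- Two distinct edges of `P` with the same tail are the two outgoing edges there.
  obtain ⟨v, hlo, hro⟩ : ∃ v, lo v ∈ P ∧ ro v ∈ P := by
    obtain ⟨e, he, f, hf, hne, hs⟩ := hP2
    refine ⟨G.src e, ?_⟩
    have h4 := (hL.src_eq _ e).1 rfl
    have h5 := (hL.src_eq _ f).1 hs.symm
    grind
  have hat := hL.mem_iff_of_at (S := {e | e ∈ P}) (hL.mem_iff_li_lo hPart hP)
    (hL.mem_iff_ri_ro hPart hP) (hL.lo_mem_iff_ro_mem h1 h2 h3 hPart hP hlo hro)
  have hwalk : ∀ {u l w}, G.IsWalk u l w → lo u ∈ P → lo w ∈ P := by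
    intro u l w h
    induction h with
    | nil => exact id
    | cons d l w _ ih => exact fun h => ih ((hat (RotationDigraph.rev d)).1 ((hat d).2 h))
  have hall : ∀ e, e ∈ P := by
    intro e
    obtain ⟨l, hl⟩ := h2.1.2 v (G.at_ (e, true))
    exact (hat (e, true)).2 (hwalk hl hlo)
  refine Set.Subset.antisymm (fun c hc => ?_) (by simpa using hP)
  obtain ⟨e, he⟩ : ∃ e, e ∈ c := by
    have hne := (hPart.circuit c hc).1
    induction c with
    | nil => exact absurd rfl hne
    | cons a l _ => exact ⟨a, by simp⟩
  exact hPart.eq_of_mem hc hP he (hall e)
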